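/- A $k$-round memoryless quantum protocol ($k$ odd) has one quantum register, initially in a fixed pure state. Alice and Bob hold classical inputs $x$ and $y$ and no other memory. In each odd round Alice, and in each even round Bob, applies to the register a unitary (possibly after adding ancillas in a fixed pure state) that depends on the player's own input only, and sends the whole register to the other player. After round $k$ Bob measures the register by a POVM that may depend on $y$ and outputs the outcome. Let $M_i$ be the register after round $i$. For inputs $(X,Y)$ drawn from a distribution $\mu$, the classical-input information cost of a protocol $\Pi$ is $$\mathrm{CIC}_\mu(\Pi)=\sum_{i\le k,\ i\text{ odd}} I(M_i:X\mid Y)+\sum_{i\le k,\ i\text{ even}} I(M_i:Y\mid X),$$ where $I(\cdot:\cdot\mid\cdot)$ is the quantum conditional mutual information, in bits. Let $\mathcal U_0$ be the uniform distribution on $\{(0,0),(0,1),(1,0)\}$, and let $\mathrm{CIC}^{\mathrm{ML}}_{\mathcal U_0,\varepsilon,k}(\mathrm{AND})$ be the infimum of $\mathrm{CIC}_{\mathcal U_0}(\Pi)$ over all $k$-round memoryless protocols $\Pi$ whose output equals $x\wedge y$ with probability at least $1-\varepsilon$ on each of the four inputs $(x,y)\in\{0,1\}^2$. **Theorem.**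 For every $\varepsilon\in(0,1/2)$ there are constants $c,C>0$, depending on $\varepsilon$ only, such that for every odd integer $k\ge 3$ the infimum $\mathrm{CIC}^{\mathrm{ML}}_{\mathcal U_0,\varepsilon,k}(\mathrm{AND})$ is taken over a non-empty set of real numbers bounded below, and $$c\,\frac{\log_2 k}{k}\ \le\ \mathrm{CIC}^{\mathrm{ML}}_{\mathcal U_0,\varepsilon,k}(\mathrm{AND})\ \le\ C\,\frac{\log_2 k}{k}.$$ -/

import Mathlib

open scoped Matrix BigOperators ComplexOrder

noncomputable section

namespace MemorylessQuantum

/-! ### Entropy and mutual information of finite-dimensional quantum systems -/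

/-- Von Neumann entropy (in bits) of a density matrix, `S(ρ) = - Tr (ρ log₂ ρ)`, the logarithm being
taken in the functional calculus of Hermitian matrices, with `0 log 0 = 0`. -/
def vonNeumannEntropy {a : Type*} [Fintype a] [DecidableEq a] (ρ : Matrix a a ℂ) : ℝ :=
  -(ρ * cfc (Real.logb 2) ρ).trace.re

/-- Partial trace over the second system: `Tr_B (ρ_AB)`. -/
def ptraceRight {a b : Type*} [Fintype b] (ρ : Matrix (a × b) (a × b) ℂ) : Matrix a a ℂ :=
  fun i j => ∑ s, ρ (i, s) (j, s)

/-- Partial trace over the first system: `Tr_A (ρ_AB)`. -/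
def ptraceLeft {a b : Type*} [Fintype a] (ρ : Matrix (a × b) (a × b) ℂ) : Matrix b b ℂ :=
  fun i j => ∑ s, ρ (s, i) (s, j)

/-- For a state on `A, B, C`, the reduced state on `A, C`. -/
def ptraceMiddle {a b c : Type*} [Fintype b] (ρ : Matrix (a × b × c) (a × b × c) ℂ) :
    Matrix (a × c) (a × c) ℂ :=
  fun i j => ∑ s, ρ (i.1, s, i.2) (j.1, s, j.2)

/-- Quantum mutual information `I(A : B) = S(A) + S(B) - S(AB)`. -/
def mutualInfo {a b : Type*} [Fintype a] [DecidableEq a] [Fintype b] [DecidableEq b]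
    (ρ : Matrix (a × b) (a × b) ℂ) : ℝ :=
  vonNeumannEntropy (ptraceRight ρ) + vonNeumannEntropy (ptraceLeft ρ) - vonNeumannEntropy ρ

/-- Quantum conditional mutual information `I(A : B | C) = I(A : BC) - I(A : C)`. -/
def condMutualInfo {a b c : Type*} [Fintype a] [DecidableEq a] [Fintype b] [DecidableEq b]
    [Fintype c] [DecidableEq c] (ρ : Matrix (a × b × c) (a × b × c) ℂ) : ℝ :=
  mutualInfo ρ - mutualInfo (ptraceMiddle ρ)

/-! ### Memoryless quantum protocols -/

/-- The state space `ℂ^d` of a register of dimension `d`. -/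
abbrev Register (d : ℕ) : Type := EuclideanSpace ℂ (Fin d)

/-- The density matrix `|ψ⟩⟨ψ|` of a pure state. -/
def pureState {d : ℕ} (ψ : Register d) : Matrix (Fin d) (Fin d) ℂ :=
  Matrix.of fun i j => ψ i * star (ψ j)

/-- A `k`-round memoryless quantum protocol (`k` odd) with classical inputs in `X` (Alice) and `Y`
(Bob) and outputs in `Z`. The only quantum register is the message register, whose dimension after
round `i` is `dim i`. It starts in a fixed pure state. In rounds `1, 3, 5, …` Alice, and in rounds
`2, 4, 6, …` Bob, applies an operation controlled by the player's own classical input to the whole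
register and sends all of it to the other player. The operations are isometries, that is, unitaries
that may act on fresh ancillas as well; they are unitary when `dim` is constant. After
round `k` Bob, who has just received the register, measures it with a POVM that may depend on his
input (this includes his last unitary). Round `i + 1` uses index `i` of `alice` if `i` is even and
of `bob` if `i` is odd; only indices `i < k` matter. -/
structure Protocol (X Y Z : Type) [Fintype Z] (k : ℕ) where
  /-- dimension of the message register after `i` rounds -/
  dim : ℕ → ℕ
  /-- initial state of the register -/
  init : Register (dim 0)
  norm_init : ‖init‖ = 1
  /-- Alice's operations -/
  alice : ∀ i : ℕ, X → (Register (dim i) →ₗᵢ[ℂ] Register (dim (i + 1)))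
  /-- Bob's operations -/
  bob : ∀ i : ℕ, Y → (Register (dim i) →ₗᵢ[ℂ] Register (dim (i + 1)))
  /-- Bob's final measurement, given his input -/
  povm : Y → Z → Matrix (Fin (dim k)) (Fin (dim k)) ℂ
  povm_posSemidef : ∀ y z, (povm y z).PosSemidef
  povm_sum : ∀ y, ∑ z, povm y z = 1

namespace Protocol

variable {X Y Z : Type} [Fintype Z] {k : ℕ}

/-- The pure state `|ψⁱ_{xy}⟩` of the message register after `i` rounds on inputs `x, y`. -/
def state (P : Protocol X Y Z k) (x : X) (y : Y) : ∀ i : ℕ, Register (P.dim i)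
  | 0 => P.init
  | i + 1 => if Even i then P.alice i x (P.state x y i) else P.bob i y (P.state x y i)

/-- The probability that Bob outputs `z` on inputs `x, y`. -/
def outputProb (P : Protocol X Y Z k) (x : X) (y : Y) (z : Z) : ℝ :=
  (pureState (P.state x y k) * P.povm y z).trace.re

/-- The protocol computes `f` with error at most `ε` (on every input). -/
def Computes (P : Protocol X Y Z k) (f : X → Y → Z) (ε : ℝ) : Prop :=
  ∀ x y, 1 - ε ≤ P.outputProb x y (f x y)

variable [Fintype X] [DecidableEq X] [Fintype Y] [DecidableEq Y]

/-- The joint state of the registers `Mᵢ, X, Y` when the inputs are drawn from `μ`: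
`∑_{x,y} μ(x,y) |ψⁱ_{xy}⟩⟨ψⁱ_{xy}| ⊗ |x⟩⟨x| ⊗ |y⟩⟨y|`. -/
def stateMXY (P : Protocol X Y Z k) (μ : X → Y → ℝ) (i : ℕ) :
    Matrix (Fin (P.dim i) × X × Y) (Fin (P.dim i) × X × Y) ℂ :=
  Matrix.of fun p q =>
    if p.2 = q.2 then (μ p.2.1 p.2.2 : ℂ) * pureState (P.state p.2.1 p.2.2 i) p.1 q.1 else 0

/-- The same joint state with the registers listed in the order `Mᵢ, Y, X`. -/
def stateMYX (P : Protocol X Y Z k) (μ : X → Y → ℝ) (i : ℕ) :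
    Matrix (Fin (P.dim i) × Y × X) (Fin (P.dim i) × Y × X) ℂ :=
  (P.stateMXY μ i).submatrix (fun p => (p.1, p.2.2, p.2.1)) (fun p => (p.1, p.2.2, p.2.1))

/-- Classical-input information cost
`CIC_μ(Π) = ∑_{i ≤ k odd} I(Mᵢ : X | Y) + ∑_{i ≤ k even} I(Mᵢ : Y | X)`
(the private quantum memories, on which one would condition too, are empty here). -/
def CIC (P : Protocol X Y Z k) (μ : X → Y → ℝ) : ℝ :=
  ∑ i ∈ Finset.Icc 1 k,
    if Odd i then condMutualInfo (P.stateMXY μ i) else condMutualInfo (P.stateMYX μ i)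

end Protocol

/-- The set of information costs of all `k`-round memoryless protocols that compute `f` with error
at most `ε`. -/
def cicValues {X Y Z : Type} [Fintype Z] [Fintype X] [DecidableEq X] [Fintype Y] [DecidableEq Y]
    (μ : X → Y → ℝ) (ε : ℝ) (k : ℕ) (f : X → Y → Z) : Set ℝ :=
  {c | ∃ P : Protocol X Y Z k, P.Computes f ε ∧ P.CIC μ = c}

/-- The `k`-round `ε`-error memoryless classical-input information complexity of `f` relative to
the input distribution `μ`. -/
def cicML {X Y Z : Type} [Fintype Z] [Fintype X] [DecidableEq X] [Fintype Y] [DecidableEq Y]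
    (μ : X → Y → ℝ) (ε : ℝ) (k : ℕ) (f : X → Y → Z) : ℝ :=
  sInf (cicValues μ ε k f)

/-- The uniform distribution on `{(0,0), (0,1), (1,0)}`. -/
def U0 (x y : Bool) : ℝ := if x = true ∧ y = true then 0 else 1 / 3

end MemorylessQuantum

end

/-! The input `(1,1)` has weight zero and the register is pure on each input, so every term of the
cost is explicit: it is `2/3 · h(D ^ 2 / 4)`, where `h` is the binary entropy and `D` is the
distance, up to a phase, between the state on `(0,0)` and the state with the last speaker's bit
flipped (`condMutualInfo_cqState_U0`, `Protocol.CIC_eq`). Both bounds are then about these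
distances.

Lower bound. A hybrid argument (`Protocol.hybrid_le`) bounds the final distance between the states
on `(1,1)` and `(0,1)` by twice the sum of the `D i`, although `(1,1)` never enters the cost. Bob
has `y = 1` in both cases and must tell them apart, so the sum is bounded below
(`Protocol.le_sum_stepDist`). By Cauchy–Schwarz the sum of the `D i ^ 2` is then at least of order
`1 / k`, and since `h(p) ≥ p log (1 / p)`, small values of `p` gain a further factor `log k`
(`sum_binEntropy_ge`).

Upper bound. On input `1` each player reflects a qubit in the real plane, about axes at a small
angle `θ` to each other. Two reflections make a rotation by `2θ`, so on `(1,1)` the state turns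
steadily, while on every other input it stays within angle `2θ` of the start. With `θ` of order `1 /
k` the final states are orthogonal, the error is zero, and each round costs at most `h(sin² θ)`,
which is of order `log k / k ^ 2`. -/

namespace MemorylessQuantum

/-! ### Entropy through characteristic polynomials -/

open Polynomial in
/-- The entropy, in nats, of the multiset of (real parts of) roots of a polynomial. -/
noncomputable def rootEntropy (p : ℂ[X]) : ℝ := (p.roots.map fun z => Real.negMulLog z.re).sum

open Polynomial in
theorem rootEntropy_mul {p q : ℂ[X]} (hp : p.Monic) (hq : q.Monic) :
    rootEntropy (p * q) = rootEntropy p + rootEntropy q := by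
  simp [rootEntropy, Polynomial.roots_mul (hp.mul hq).ne_zero]

open Polynomial in
theorem rootEntropy_X_pow (n : ℕ) : rootEntropy (X ^ n : ℂ[X]) = 0 := by
  simp [rootEntropy, Multiset.map_nsmul, Multiset.sum_nsmul]

open Polynomial in
theorem rootEntropy_X_sub_C (a : ℝ) : rootEntropy (X - C (a : ℂ)) = Real.negMulLog a := by
  simp [rootEntropy]

theorem vonNeumannEntropy_eq_rootEntropy {a : Type*} [Fintype a] [DecidableEq a]
    {ρ : Matrix a a ℂ} (hρ : ρ.IsHermitian) :
    vonNeumannEntropy ρ = rootEntropy ρ.charpoly / Real.log 2 := by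
  have h : ρ * cfc (Real.logb 2) ρ = cfc (fun x : ℝ => x * Real.logb 2 x) ρ := by
    have := cfc_mul (fun x : ℝ => x) (Real.logb 2) ρ
      (by fun_prop) (Set.Finite.continuousOn (Matrix.finite_real_spectrum) _)
    rw [this, cfc_id' ℝ ρ hρ.isSelfAdjoint]
  rw [vonNeumannEntropy, h, hρ.cfc_eq, Matrix.IsHermitian.cfc, Unitary.conjStarAlgAut_apply,
    Matrix.trace_mul_comm, ← mul_assoc]
  simp only [Unitary.coe_star_mul_self, one_mul, rootEntropy,
    hρ.roots_charpoly_eq_eigenvalues, Matrix.trace_diagonal]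
  simp only [Function.comp_apply, Multiset.map_map, ← Finset.sum_eq_multiset_sum,
    Complex.coe_algebraMap, ← Complex.ofReal_sum, Complex.ofReal_re]
  simp only [Real.negMulLog, Real.logb, Finset.sum_div, ← Finset.sum_neg_distrib]
  exact Finset.sum_congr rfl fun i _ => by ring

/-- `A * Aᴴ` and `Aᴴ * A` have the same nonzero spectrum, and the extra zero roots carry no entropy
because `0 log 0 = 0`. This replaces density matrices of arbitrary dimension by small Gram matrices.
-/
theorem vonNeumannEntropy_mul_comm {a b : Type*} [Fintype a] [DecidableEq a] [Fintype b]
    [DecidableEq b] (A : Matrix a b ℂ) :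
    vonNeumannEntropy (A * Aᴴ) = rootEntropy (Aᴴ * A).charpoly / Real.log 2 := by
  rw [vonNeumannEntropy_eq_rootEntropy (Matrix.isHermitian_mul_conjTranspose_self A)]
  have := congrArg rootEntropy (Matrix.charpoly_mul_comm' A Aᴴ)
  rw [rootEntropy_mul (Polynomial.monic_X_pow _) (Matrix.charpoly_monic _),
    rootEntropy_mul (Polynomial.monic_X_pow _) (Matrix.charpoly_monic _), rootEntropy_X_pow,
    rootEntropy_X_pow, zero_add, zero_add] at this
  rw [this]

theorem charpoly_blockDiagonal {m o : Type*} [Fintype m] [DecidableEq m] [Fintype o]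
    [DecidableEq o] (M : o → Matrix m m ℂ) :
    (Matrix.blockDiagonal M).charpoly = ∏ k, (M k).charpoly := by
  simp only [Matrix.charpoly, ← Matrix.det_blockDiagonal]
  congr 1
  ext ⟨i, k⟩ ⟨j, l⟩ : 1
  by_cases h : k = l <;> by_cases h' : i = j <;>
    simp [Matrix.blockDiagonal_apply, h, h']

open Polynomial in
theorem charpoly_bool (M : Matrix Bool Bool ℂ) :
    M.charpoly = X ^ 2 - C (M false false + M true true) * X
      + C (M false false * M true true - M false true * M true false) := by
  rw [← Matrix.charpoly_reindex finTwoEquiv.symm, Matrix.charpoly_fin_two,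
    Matrix.trace_fin_two, Matrix.det_fin_two]
  simp [finTwoEquiv]

theorem vonNeumannEntropy_diagonal {a : Type*} [Fintype a] [DecidableEq a] (v : a → ℝ) :
    vonNeumannEntropy (Matrix.diagonal fun i => (v i : ℂ)) =
      (∑ i, Real.negMulLog (v i)) / Real.log 2 := by
  rw [vonNeumannEntropy_eq_rootEntropy, Matrix.charpoly_diagonal, rootEntropy,
    Polynomial.roots_prod _ _ (Finset.prod_ne_zero_iff.mpr fun i _ => Polynomial.X_sub_C_ne_zero _)]
  · simp [Multiset.bind_singleton]
  · exact Matrix.isHermitian_diagonal_of_self_adjoint _ (by ext; simp)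

theorem rootEntropy_prod {o : Type*} (s : Finset o) (p : o → Polynomial ℂ)
    (hp : ∀ i, (p i).Monic) : rootEntropy (∏ i ∈ s, p i) = ∑ i ∈ s, rootEntropy (p i) := by
  classical
  induction s using Finset.induction_on with
  | empty => simp [rootEntropy]
  | insert a s ha ih =>
    rw [Finset.prod_insert ha, Finset.sum_insert ha,
      rootEntropy_mul (hp a) (Polynomial.monic_prod_of_monic _ _ fun i _ => hp i), ih]

/-! ### Conditional mutual information of classical-quantum states with pure conditional states -/

section CQ

variable {A B : Type} [Fintype A] [DecidableEq A] [Fintype B] [DecidableEq B] {d : ℕ}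

/-- The classical-quantum state `∑ μ(a,b) |φ_ab⟩⟨φ_ab| ⊗ |a⟩⟨a| ⊗ |b⟩⟨b|`. -/
noncomputable def cqState (μ : A → B → ℝ) (φ : A → B → Register d) :
    Matrix (Fin d × A × B) (Fin d × A × B) ℂ :=
  Matrix.of fun p q =>
    if p.2 = q.2 then (μ p.2.1 p.2.2 : ℂ) * pureState (φ p.2.1 p.2.2) p.1 q.1 else 0

/-- The weighted Gram matrix of the family `φ · b`. -/
noncomputable def gramMatrix (μ : A → B → ℝ) (φ : A → B → Register d) (b : B) : Matrix A A ℂ :=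
  Matrix.of fun a a' => (√(μ a b) * √(μ a' b) : ℝ) * inner ℂ (φ a b) (φ a' b)

variable {μ : A → B → ℝ} {φ : A → B → Register d}

theorem sqrt_mul_sqrt_complex {x : ℝ} (hx : 0 ≤ x) : ((√x : ℝ) : ℂ) * ((√x : ℝ) : ℂ) = x := by
  rw [← Complex.ofReal_mul, Real.mul_self_sqrt hx]

theorem inner_register (u v : Register d) : inner ℂ u v = ∑ i, star (u i) * v i := by
  simp [PiLp.inner_apply, mul_comm]

theorem vonNeumannEntropy_cqState (hμ : ∀ a b, 0 ≤ μ a b) (hφ : ∀ a b, ‖φ a b‖ = 1) :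
    vonNeumannEntropy (cqState μ φ) = (∑ p : A × B, Real.negMulLog (μ p.1 p.2)) / Real.log 2 := by
  let F : Matrix (Fin d × A × B) (A × B) ℂ := Matrix.of fun p q =>
    if p.2 = q then ((√(μ q.1 q.2) : ℝ) : ℂ) * φ q.1 q.2 p.1 else 0
  have h1 : cqState μ φ = F * Fᴴ := by
    ext ⟨i, p⟩ ⟨j, q⟩
    by_cases h : p = q
    · subst h
      simp only [cqState, Matrix.of_apply, Matrix.mul_apply, Matrix.conjTranspose_apply, F]
      rw [Finset.sum_eq_single p (fun b _ hb => by simp [hb.symm]) (by simp)]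
      simp only [if_true, pureState, Matrix.of_apply, ← sqrt_mul_sqrt_complex (hμ p.1 p.2),
        star_mul', Complex.star_def, Complex.conj_ofReal]
      ring
    · simp only [cqState, Matrix.of_apply, Matrix.mul_apply, Matrix.conjTranspose_apply, F, h,
        if_false]
      refine (Finset.sum_eq_zero fun b _ => ?_).symm
      by_cases h' : p = b
      · have : q ≠ b := fun e => h (h'.trans e.symm)
        simp [this]
      · simp [h']
  have h2 : Fᴴ * F = Matrix.diagonal fun p : A × B => (μ p.1 p.2 : ℂ) := by
    ext p q
    simp only [Matrix.mul_apply, Matrix.conjTranspose_apply, F, Matrix.of_apply,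
      Fintype.sum_prod_type (α₁ := Fin d)]
    by_cases h : p = q
    · subst h
      have : (1 : ℂ) = ∑ i, star (φ p.1 p.2 i) * φ p.1 p.2 i := by
        rw [← inner_register, inner_self_eq_norm_sq_to_K, hφ]; simp
      rw [Matrix.diagonal_apply_eq, ← mul_one (μ p.1 p.2 : ℂ), this, Finset.mul_sum]
      refine Finset.sum_congr rfl fun i _ => ?_
      rw [Finset.sum_eq_single p (fun b _ hb => by simp [hb]) (by simp)]
      simp only [if_true, ← sqrt_mul_sqrt_complex (hμ p.1 p.2),
        star_mul', Complex.star_def, Complex.conj_ofReal]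
      ring
    · rw [Matrix.diagonal_apply_ne _ h]
      refine Finset.sum_eq_zero fun i _ => Finset.sum_eq_zero fun b _ => ?_
      by_cases h' : b = p
      · have : b ≠ q := fun e => h (h'.symm.trans e)
        simp [this]
      · simp [h']
  have h3 := vonNeumannEntropy_mul_comm F
  rw [h2, ← vonNeumannEntropy_eq_rootEntropy
    (Matrix.isHermitian_diagonal_of_self_adjoint _ (by ext; simp)),
    vonNeumannEntropy_diagonal (fun p : A × B => μ p.1 p.2)] at h3
  rw [h1, h3]

/-- Factor the state as `F * Fᴴ`, the columns of `F` being the weighted vectors. Then `Fᴴ * F` is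
block diagonal with one Gram matrix for each value of the classical register that is kept. -/
theorem vonNeumannEntropy_ptraceMiddle_cqState (hμ : ∀ a b, 0 ≤ μ a b) :
    vonNeumannEntropy (ptraceMiddle (cqState μ φ)) =
      (∑ b, rootEntropy (gramMatrix μ φ b).charpoly) / Real.log 2 := by
  let F : Matrix (Fin d × B) (A × B) ℂ := Matrix.of fun p q =>
    if p.2 = q.2 then ((√(μ q.1 q.2) : ℝ) : ℂ) * φ q.1 q.2 p.1 else 0
  have h1 : ptraceMiddle (cqState μ φ) = F * Fᴴ := by
    ext ⟨i, b⟩ ⟨j, b'⟩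
    simp only [ptraceMiddle, cqState, Matrix.of_apply, Matrix.mul_apply,
      Matrix.conjTranspose_apply, F, Fintype.sum_prod_type]
    refine Finset.sum_congr rfl fun a _ => ?_
    rw [Finset.sum_eq_single b (fun c _ hc => by simp [hc.symm]) (by simp)]
    by_cases h : b = b'
    · subst h
      simp only [if_true, pureState, Matrix.of_apply, ← sqrt_mul_sqrt_complex (hμ a b),
        star_mul', Complex.star_def, Complex.conj_ofReal]
      ring
    · simp [h, Ne.symm h]
  have h2 : Fᴴ * F = Matrix.blockDiagonal (gramMatrix μ φ) := by
    ext ⟨a, b⟩ ⟨a', b'⟩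
    simp only [Matrix.mul_apply, Matrix.conjTranspose_apply, F, Matrix.of_apply,
      Fintype.sum_prod_type, Matrix.blockDiagonal_apply, gramMatrix, inner_register]
    by_cases h : b = b'
    · subst h
      rw [if_pos rfl, Finset.mul_sum]
      refine Finset.sum_congr rfl fun i _ => ?_
      rw [Finset.sum_eq_single b (fun c _ hc => by simp [hc]) (by simp)]
      simp only [if_true, star_mul', Complex.star_def, Complex.conj_ofReal, Complex.ofReal_mul]
      ring
    · rw [if_neg h]
      refine Finset.sum_eq_zero fun i _ => Finset.sum_eq_zero fun c _ => ?_
      by_cases h' : c = b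
      · have : c ≠ b' := fun e => h (h'.symm.trans e)
        simp [this]
      · simp [h']
  rw [h1, vonNeumannEntropy_mul_comm, h2, charpoly_blockDiagonal,
    rootEntropy_prod _ _ fun b => Matrix.charpoly_monic _]

theorem sum_pureState {u : Register d} (hu : ‖u‖ = 1) : ∑ i, pureState u i i = 1 := by
  have := inner_self_eq_norm_sq_to_K (𝕜 := ℂ) u
  rw [inner_register, hu] at this
  simpa [pureState, mul_comm] using this

/-- Purity gives `S(MAB) = S(AB)`, so `I(M : AB) = S(M)`. Subtracting `I(M : B)` leaves `S(MB) -
S(B)`. -/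
theorem condMutualInfo_cqState (hμ : ∀ a b, 0 ≤ μ a b) (hφ : ∀ a b, ‖φ a b‖ = 1) :
    condMutualInfo (cqState μ φ) =
      (∑ b, rootEntropy (gramMatrix μ φ b).charpoly - ∑ b, Real.negMulLog (∑ a, μ a b)) /
        Real.log 2 := by
  have h1 : ptraceLeft (cqState μ φ) = Matrix.diagonal fun p : A × B => (μ p.1 p.2 : ℂ) := by
    ext p q
    by_cases h : p = q
    · subst h
      simp [ptraceLeft, cqState, ← Finset.mul_sum, sum_pureState (hφ p.1 p.2)]
    · simp [ptraceLeft, cqState, h]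
  have h2 : ptraceLeft (ptraceMiddle (cqState μ φ)) =
      Matrix.diagonal fun b : B => ((∑ a, μ a b : ℝ) : ℂ) := by
    ext p q
    by_cases h : p = q
    · subst h
      simp only [ptraceLeft, ptraceMiddle, cqState, Matrix.of_apply, if_true,
        Matrix.diagonal_apply_eq, Complex.ofReal_sum]
      rw [Finset.sum_comm]
      exact Finset.sum_congr rfl fun a _ => by rw [← Finset.mul_sum, sum_pureState (hφ a p), mul_one]
    · simp [ptraceLeft, ptraceMiddle, cqState, h]
  have h3 : ptraceRight (ptraceMiddle (cqState μ φ)) = ptraceRight (cqState μ φ) := by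
    ext i j
    simp only [ptraceRight, ptraceMiddle, cqState, Matrix.of_apply, Fintype.sum_prod_type]
    rw [Finset.sum_comm]
  rw [condMutualInfo, mutualInfo, mutualInfo, h1, h2, h3, vonNeumannEntropy_cqState hμ hφ,
    vonNeumannEntropy_ptraceMiddle_cqState hμ, vonNeumannEntropy_diagonal (fun p : A × B => μ p.1 p.2),
    vonNeumannEntropy_diagonal fun b => ∑ a, μ a b]
  ring

end CQ

theorem U0_nonneg (x y : Bool) : 0 ≤ U0 x y := by
  unfold U0; split_ifs <;> norm_num

open Polynomial in
-- For `b = 1` only `a = 0` has weight, so that block has rank one and contributes nothing after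
-- subtraction. The block for `b = 0` has eigenvalues `(1 ± ‖c‖) / 3`; the factor `2/3` is the
-- probability of `b = 0`.
theorem condMutualInfo_cqState_U0 {d : ℕ} {φ : Bool → Bool → Register d}
    (hφ : ∀ a b, ‖φ a b‖ = 1) :
    condMutualInfo (cqState U0 φ) =
      2 / 3 * (Real.binEntropy ((1 - ‖inner ℂ (φ false false) (φ true false)‖) / 2)
        / Real.log 2) := by
  rw [condMutualInfo_cqState U0_nonneg hφ]
  set c := inner ℂ (φ false false) (φ true false) with hc
  have hc' : inner ℂ (φ true false) (φ false false) = (starRingEnd ℂ) c := by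
    rw [hc, inner_conj_symm]
  have hs : ∀ a b, inner ℂ (φ a b) (φ a b) = (1 : ℂ) := fun a b => by
    rw [inner_self_eq_norm_sq_to_K, hφ]; simp
  have h3 : ((√(3⁻¹ : ℝ) : ℝ) : ℂ) * ((√(3⁻¹ : ℝ) : ℝ) : ℂ) = 3⁻¹ := by
    rw [sqrt_mul_sqrt_complex (by norm_num)]; norm_num
  have g0 : (gramMatrix U0 φ false).charpoly =
      (X - C (((1 + ‖c‖) / 3 : ℝ) : ℂ)) * (X - C (((1 - ‖c‖) / 3 : ℝ) : ℂ)) := by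
    have e : (3⁻¹ : ℂ) * 3⁻¹ - 3⁻¹ * c * (3⁻¹ * (starRingEnd ℂ) c) =
        (((1 + ‖c‖) / 3 : ℝ) : ℂ) * (((1 - ‖c‖) / 3 : ℝ) : ℂ) := by
      have := Complex.mul_conj' c
      push_cast
      linear_combination (-1/9 : ℂ) * this
    have e' : (3⁻¹ : ℂ) + 3⁻¹ = (((1 + ‖c‖) / 3 : ℝ) : ℂ) + (((1 - ‖c‖) / 3 : ℝ) : ℂ) := by
      push_cast; ring
    rw [charpoly_bool]
    simp only [gramMatrix, Matrix.of_apply, hs, U0, Complex.ofReal_mul, one_div, Bool.false_eq_true,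
      and_false, if_false, h3, hc', ← hc, mul_one, e, e']
    simp only [C_mul, C_add]
    ring
  have g1 : (gramMatrix U0 φ true).charpoly = (X - C (((1 / 3 : ℝ)) : ℂ)) * X ^ 1 := by
    rw [charpoly_bool]
    simp only [gramMatrix, Matrix.of_apply, hs, U0, Complex.ofReal_mul, one_div, Bool.false_eq_true,
      and_true, if_false, if_true, h3, mul_one, Real.sqrt_zero,
      Complex.ofReal_zero, mul_zero, zero_mul, add_zero, sub_zero, C_0]
    push_cast
    ring
  rw [Fintype.sum_bool, Fintype.sum_bool, Fintype.sum_bool, Fintype.sum_bool, g0, g1,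
    rootEntropy_mul (monic_X_sub_C _) (monic_X_sub_C _),
    rootEntropy_mul (monic_X_sub_C _) (monic_X_pow _), rootEntropy_X_pow,
    rootEntropy_X_sub_C, rootEntropy_X_sub_C, rootEntropy_X_sub_C]
  have e1 : (1 + ‖c‖) / 3 = 2 / 3 * (1 - (1 - ‖c‖) / 2) := by ring
  have e2 : (1 - ‖c‖) / 3 = 2 / 3 * ((1 - ‖c‖) / 2) := by ring
  rw [e1, e2, Real.negMulLog_mul, Real.negMulLog_mul,
    Real.binEntropy_eq_negMulLog_add_negMulLog_one_sub]
  simp only [U0]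
  norm_num
  ring

/-! ### Distance of pure states up to a phase -/

/-- The distance of two unit vectors up to a phase. -/
noncomputable def phaseDist {d : ℕ} (u v : Register d) : ℝ := √(2 - 2 * ‖(inner ℂ u v : ℂ)‖)

section PhaseDist

variable {d : ℕ} {u v w : Register d}

theorem norm_inner_le_one (hu : ‖u‖ = 1) (hv : ‖v‖ = 1) : ‖(inner ℂ u v : ℂ)‖ ≤ 1 := by
  simpa [hu, hv] using norm_inner_le_norm (𝕜 := ℂ) u v

theorem norm_sub_smul_sq (hu : ‖u‖ = 1) (hv : ‖v‖ = 1) {z : ℂ} (hz : ‖z‖ = 1) :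
    ‖u - z • v‖ ^ 2 = 2 - 2 * (z * inner ℂ u v).re := by
  rw [norm_sub_sq (𝕜 := ℂ), inner_smul_right, norm_smul, hu, hv, hz, RCLike.re_eq_complex_re]
  ring

theorem phaseDist_le_norm (hu : ‖u‖ = 1) (hv : ‖v‖ = 1) {z : ℂ} (hz : ‖z‖ = 1) :
    phaseDist u v ≤ ‖u - z • v‖ := by
  refine Real.sqrt_le_iff.mpr ⟨norm_nonneg _, ?_⟩
  rw [norm_sub_smul_sq hu hv hz]
  have := (z * inner ℂ u v).re_le_norm
  rw [norm_mul, hz, one_mul] at this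
  linarith

/-- The minimum over phases is attained by the phase that makes the inner product real and
nonnegative. The triangle inequality follows by composing two optimal phases. -/
theorem exists_phase_norm_eq (hu : ‖u‖ = 1) (hv : ‖v‖ = 1) :
    ∃ z : ℂ, ‖z‖ = 1 ∧ ‖u - z • v‖ = phaseDist u v := by
  obtain ⟨z, hz, h⟩ : ∃ z : ℂ, ‖z‖ = 1 ∧ (z * inner ℂ u v).re = ‖(inner ℂ u v : ℂ)‖ := by
    obtain ⟨z, hz, h⟩ := RCLike.exists_norm_eq_mul_self (inner ℂ u v : ℂ)
    refine ⟨z, hz, ?_⟩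
    rw [← h]; simp
  refine ⟨z, hz, ?_⟩
  rw [phaseDist, ← h, ← norm_sub_smul_sq hu hv hz, Real.sqrt_sq (norm_nonneg _)]

theorem phaseDist_nonneg : 0 ≤ phaseDist u v := Real.sqrt_nonneg _

theorem phaseDist_self (hu : ‖u‖ = 1) : phaseDist u u = 0 := by
  simp [phaseDist, hu]

theorem phaseDist_comm (u v : Register d) : phaseDist u v = phaseDist v u := by
  rw [phaseDist, norm_inner_symm, phaseDist]

theorem phaseDist_map {d' : ℕ} (f : Register d →ₗᵢ[ℂ] Register d') (u v : Register d) :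
    phaseDist (f u) (f v) = phaseDist u v := by
  rw [phaseDist, f.inner_map_map, phaseDist]

theorem phaseDist_triangle (hu : ‖u‖ = 1) (hv : ‖v‖ = 1) (hw : ‖w‖ = 1) :
    phaseDist u w ≤ phaseDist u v + phaseDist v w := by
  obtain ⟨z, hz, h⟩ := exists_phase_norm_eq hu hv
  obtain ⟨z', hz', h'⟩ := exists_phase_norm_eq hv hw
  have e : u - (z * z') • w = (u - z • v) + z • (v - z' • w) := by
    rw [smul_sub, smul_smul]; abel
  calc phaseDist u w ≤ ‖u - (z * z') • w‖ := phaseDist_le_norm hu hw (by simp [hz, hz'])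
    _ ≤ ‖u - z • v‖ + ‖z • (v - z' • w)‖ := e ▸ norm_add_le _ _
    _ = phaseDist u v + phaseDist v w := by rw [norm_smul, hz, one_mul, h, h']

end PhaseDist

/-! ### Measurement statistics of nearby states -/

section Measurement

variable {d : ℕ}

theorem trace_pureState_mul (u : Register d) (B : Matrix (Fin d) (Fin d) ℂ) :
    (pureState u * (Bᴴ * B)).trace.re = ‖Matrix.toEuclideanLin B u‖ ^ 2 := by
  have e : pureState u = Matrix.vecMulVec u.ofLp (star u.ofLp) := by
    ext i j; simp [pureState, Matrix.vecMulVec_apply]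
  rw [e, Matrix.vecMulVec_mul, Matrix.trace_vecMulVec, ← Matrix.vecMul_vecMul,
    ← Matrix.star_mulVec, dotProduct_comm, ← Matrix.dotProduct_mulVec, EuclideanSpace.norm_sq_eq]
  simp [dotProduct, Complex.re_sum, Complex.conj_mul', ← Complex.ofReal_pow,
    Matrix.toLpLin_apply]

theorem trace_pureState (u : Register d) : (pureState u).trace.re = ‖u‖ ^ 2 := by
  have := trace_pureState_mul u 1
  simpa using this

theorem pureState_smul (u : Register d) {z : ℂ} (hz : ‖z‖ = 1) :
    pureState (z • u) = pureState u := by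
  ext i j
  have : z * (starRingEnd ℂ) z = 1 := by rw [Complex.mul_conj', hz]; simp
  simp only [pureState, Matrix.of_apply, PiLp.smul_apply, smul_eq_mul, star_mul', Complex.star_def]
  linear_combination (u i * (starRingEnd ℂ) (u j)) * this

open scoped MatrixOrder Matrix.Norms.L2Operator in
-- Writing `E = Bᴴ * B` makes the root of the probability equal to `‖B u‖`. The complementary effect
-- `F` forces `B` to be a contraction, and the phase of `v` does not affect the probability.
theorem sqrt_prob_sub_le {u v : Register d} (hu : ‖u‖ = 1) (hv : ‖v‖ = 1)
    {E F : Matrix (Fin d) (Fin d) ℂ} (hE : E.PosSemidef) (hF : F.PosSemidef) (h : E + F = 1) :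
    √(pureState u * E).trace.re ≤ √(pureState v * E).trace.re + phaseDist u v := by
  obtain ⟨B, rfl⟩ := CStarAlgebra.nonneg_iff_eq_star_mul_self.mp hE.nonneg
  obtain ⟨C, rfl⟩ := CStarAlgebra.nonneg_iff_eq_star_mul_self.mp hF.nonneg
  simp only [Matrix.star_eq_conjTranspose] at h ⊢
  obtain ⟨z, hz, hd⟩ := exists_phase_norm_eq hu hv
  have hB : ∀ w : Register d, ‖Matrix.toEuclideanLin B w‖ ≤ ‖w‖ := fun w => by
    have := congrArg (fun M => (pureState w * M).trace.re) h
    simp only [mul_add, Matrix.trace_add, Complex.add_re, mul_one, trace_pureState,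
      trace_pureState_mul] at this
    exact le_of_sq_le_sq (by nlinarith [sq_nonneg ‖Matrix.toEuclideanLin C w‖]) (norm_nonneg _)
  rw [← pureState_smul v hz, trace_pureState_mul, trace_pureState_mul,
    Real.sqrt_sq (norm_nonneg _), Real.sqrt_sq (norm_nonneg _), ← hd]
  have e : Matrix.toEuclideanLin B u = Matrix.toEuclideanLin B (z • v) +
      Matrix.toEuclideanLin B (u - z • v) := by rw [← map_add]; simp
  rw [e]
  exact (norm_add_le _ _).trans (add_le_add_right (hB _) _)

end Measurement

/-! ### Cost formula and hybrid argument -/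

namespace Protocol

variable {X Y Z : Type} [Fintype Z] {k : ℕ}

theorem norm_state (P : Protocol X Y Z k) (x : X) (y : Y) (i : ℕ) : ‖P.state x y i‖ = 1 := by
  induction i with
  | zero => exact P.norm_init
  | succ i ih =>
    rw [state]
    split_ifs
    · rw [LinearIsometry.norm_map, ih]
    · rw [LinearIsometry.norm_map, ih]

theorem state_succ_of_even (P : Protocol X Y Z k) (x : X) (y : Y) {i : ℕ} (hi : Even i) :
    P.state x y (i + 1) = P.alice i x (P.state x y i) := by rw [state, if_pos hi]

theorem state_succ_of_not_even (P : Protocol X Y Z k) (x : X) (y : Y) {i : ℕ} (hi : ¬ Even i) :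
    P.state x y (i + 1) = P.bob i y (P.state x y i) := by rw [state, if_neg hi]

/-- The phase distance of the states after round `i` on the inputs `(0,0)` and the input in which
the bit of the player who acted last is flipped. -/
noncomputable def stepDist {k : ℕ} (P : Protocol Bool Bool Bool k) (i : ℕ) : ℝ :=
  if Odd i then phaseDist (P.state false false i) (P.state true false i)
  else phaseDist (P.state false false i) (P.state false true i)

theorem stepDist_sq_le (P : Protocol Bool Bool Bool k) (i : ℕ) : P.stepDist i ^ 2 ≤ 2 := by
  have h : ∀ u v : Register (P.dim i), phaseDist u v ^ 2 ≤ 2 := fun u v => by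
    rw [phaseDist, Real.sq_sqrt']
    exact max_le (by linarith [norm_nonneg (inner ℂ u v : ℂ)]) (by norm_num)
  unfold stepDist; split_ifs <;> exact h _ _

theorem condMutualInfo_eq_phaseDist {d : ℕ} {φ : Bool → Bool → Register d}
    (hφ : ∀ a b, ‖φ a b‖ = 1) :
    condMutualInfo (cqState U0 φ) =
      2 / 3 * (Real.binEntropy (phaseDist (φ false false) (φ true false) ^ 2 / 4)
        / Real.log 2) := by
  rw [condMutualInfo_cqState_U0 hφ, phaseDist, Real.sq_sqrt
    (by linarith [norm_inner_le_one (hφ false false) (hφ true false)])]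
  have e : (1 - ‖(inner ℂ (φ false false) (φ true false) : ℂ)‖) / 2 =
      (2 - 2 * ‖(inner ℂ (φ false false) (φ true false) : ℂ)‖) / 4 := by ring
  rw [e]

theorem CIC_eq (P : Protocol Bool Bool Bool k) :
    P.CIC U0 = 2 / 3 / Real.log 2 *
      ∑ i ∈ Finset.Icc 1 k, Real.binEntropy (P.stepDist i ^ 2 / 4) := by
  rw [CIC, Finset.mul_sum]
  refine Finset.sum_congr rfl fun i _ => ?_
  unfold stepDist
  split_ifs
  · have : P.stateMXY U0 i = cqState U0 fun x y => P.state x y i := rfl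
    rw [this, condMutualInfo_eq_phaseDist fun x y => P.norm_state x y i]
    ring
  -- Even rounds reduce to the odd case with the players exchanged, because `U0` is symmetric.
  · have : P.stateMYX U0 i = cqState U0 fun y x => P.state x y i := by
      ext ⟨m, y, x⟩ ⟨m', y', x'⟩
      simp only [stateMYX, stateMXY, cqState, Matrix.submatrix_apply, Matrix.of_apply,
        Prod.mk.injEq, and_comm, U0]
    rw [this, condMutualInfo_eq_phaseDist fun y x => P.norm_state x y i]
    ring

theorem CIC_nonneg (P : Protocol Bool Bool Bool k) : 0 ≤ P.CIC U0 := by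
  rw [CIC_eq]
  have := Real.log_pos one_lt_two
  refine mul_nonneg (by positivity) (Finset.sum_nonneg fun i _ => ?_)
  exact Real.binEntropy_nonneg (by positivity) (by linarith [P.stepDist_sq_le i])

/-- The two extra terms on the left are a potential that makes the induction close. In a Bob round
the first two distances compare inputs with equal `y`, so they do not change, and the third is paid
for by the new step. In an Alice round the stored potential pays for moving from `(1,1)` to `(0,1)`
through `(1,0)` and `(0,0)`. -/
theorem hybrid_le (P : Protocol Bool Bool Bool k) (i : ℕ) :
    phaseDist (P.state true true i) (P.state false true i) +
      phaseDist (P.state false false i) (P.state true false i) +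
      (if Even i then 2 * phaseDist (P.state false false i) (P.state false true i) else 0) ≤
      2 * ∑ j ∈ Finset.Icc 1 i, P.stepDist j := by
  induction i with
  | zero => simp [state, phaseDist_self P.norm_init]
  | succ i ih =>
    rw [Finset.sum_Icc_succ_top (by omega), mul_add]
    by_cases hi : Even i
    · have ho : Odd (i + 1) := hi.add_one
      rw [if_pos hi] at ih
      rw [if_neg (Nat.not_even_iff_odd.mpr ho), stepDist, if_pos ho]
      have n := fun x y => P.norm_state x y (i + 1)
      -- With `A₀`, `A₁` Alice's operations, the path is `A₁ψ₁₁, A₁ψ₀₁, A₁ψ₀₀, A₁ψ₁₀, A₀ψ₀₀, A₀ψ₀₁`.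
      -- All steps but the fourth are under a common isometry; the fourth is the new distance
      -- between `(1,0)` and `(0,0)`.
      have t : phaseDist (P.state true true (i + 1)) (P.state false true (i + 1)) ≤
          phaseDist (P.state true true i) (P.state false true i) +
          2 * phaseDist (P.state false false i) (P.state false true i) +
          phaseDist (P.state false false i) (P.state true false i) +
          phaseDist (P.state false false (i + 1)) (P.state true false (i + 1)) := by
        have na : ∀ x x' y, ‖P.alice i x (P.state x' y i)‖ = 1 := fun x x' y => by
          rw [LinearIsometry.norm_map, norm_state]
        have t1 := phaseDist_triangle (na true true true) (na true false true) (na false false true)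
        have t2 := phaseDist_triangle (na true false true) (na true false false)
          (na false false true)
        have t3 := phaseDist_triangle (na true false false) (na true true false)
          (na false false true)
        have t4 := phaseDist_triangle (na true true false) (na false false false)
          (na false false true)
        rw [phaseDist_comm (P.alice i true (P.state true false i))
          (P.alice i false (P.state false false i))] at t4
        rw [phaseDist_map, phaseDist_comm (P.state false true i)] at t2
        rw [phaseDist_map] at t1 t3
        rw [phaseDist_map (P.alice i false) (P.state false false i)] at t4
        simp only [P.state_succ_of_even _ _ hi]
        linarith
      linarith
    · have he : Even (i + 1) := (Nat.not_even_iff_odd.mp hi).add_one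
      rw [if_neg hi] at ih
      rw [if_pos he, stepDist, if_neg (Nat.not_odd_iff_even.mpr he)]
      have h1 : phaseDist (P.state true true (i + 1)) (P.state false true (i + 1)) =
          phaseDist (P.state true true i) (P.state false true i) := by
        simp only [P.state_succ_of_not_even _ _ hi, phaseDist_map]
      have h2 : phaseDist (P.state false false (i + 1)) (P.state true false (i + 1)) =
          phaseDist (P.state false false i) (P.state true false i) := by
        simp only [P.state_succ_of_not_even _ _ hi, phaseDist_map]
      linarith

theorem sum_outputProb (P : Protocol X Y Z k) (x : X) (y : Y) : ∑ z, P.outputProb x y z = 1 := by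
  simp only [outputProb]
  rw [← Complex.re_sum, ← Matrix.trace_sum, ← Finset.mul_sum, P.povm_sum, mul_one, trace_pureState,
    norm_state, one_pow]

theorem le_sum_stepDist (P : Protocol Bool Bool Bool k) {ε : ℝ} (h : P.Computes and ε) :
    √(1 - ε) - √ε ≤ 2 * ∑ j ∈ Finset.Icc 1 k, P.stepDist j := by
  have h1 : 1 - ε ≤ P.outputProb true true true := h true true
  have h2 : 1 - ε ≤ P.outputProb false true false := h false true
  have h3 := P.sum_outputProb false true
  rw [Fintype.sum_bool] at h3
  have h4 : P.outputProb false true true ≤ ε := by linarith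
  have hE := P.povm_sum true
  rw [Fintype.sum_bool] at hE
  have h5 := sqrt_prob_sub_le (P.norm_state true true k) (P.norm_state false true k)
    (P.povm_posSemidef true true) (P.povm_posSemidef true false) hE
  have h6 := Real.sqrt_le_sqrt h1
  have h7 := Real.sqrt_le_sqrt h4
  unfold outputProb at h6 h7
  have h8 := P.hybrid_le k
  have h9 : 0 ≤ (if Even k then
      2 * phaseDist (P.state false false k) (P.state false true k) else 0) := by
    split_ifs
    · exact mul_nonneg zero_le_two phaseDist_nonneg
    · exact le_rfl
  have h10 : 0 ≤ phaseDist (P.state false false k) (P.state true false k) := phaseDist_nonneg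
  linarith

end Protocol

/-! ### Lower bound on a sum of binary entropies -/

theorem negMulLog_le_binEntropy {p : ℝ} (h0 : 0 ≤ p) (h1 : p ≤ 1) :
    Real.negMulLog p ≤ Real.binEntropy p := by
  rw [Real.binEntropy_eq_negMulLog_add_negMulLog_one_sub]
  linarith [Real.negMulLog_nonneg (x := 1 - p) (by linarith) (by linarith)]

theorem mul_le_binEntropy {p t : ℝ} (h0 : 0 ≤ p) (h1 : p ≤ 1) (ht : p ≤ Real.exp (-t)) :
    p * t ≤ Real.binEntropy p := by
  refine le_trans ?_ (negMulLog_le_binEntropy h0 h1)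
  rcases h0.eq_or_lt with rfl | h0
  · simp
  have := (Real.log_le_iff_le_exp h0).mpr ht
  rw [Real.negMulLog]
  nlinarith

theorem sum_binEntropy_ge {k : ℕ} (hk : 1 ≤ k) {D : ℕ → ℝ} (h2 : ∀ i, D i ^ 2 ≤ 2)
    {r : ℝ} (hr : 0 ≤ r) (h : r ≤ 2 * ∑ i ∈ Finset.Icc 1 k, D i) :
    min (r ^ 2 / 32) (Real.log 2 / 2) * (Real.log k / k) ≤
      ∑ i ∈ Finset.Icc 1 k, Real.binEntropy (D i ^ 2 / 4) := by
  have hk0 : (0 : ℝ) < k := by exact_mod_cast hk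
  have hk1 : (1 : ℝ) ≤ k := by exact_mod_cast hk
  have hl := Real.log_nonneg hk1
  have hlk : 0 ≤ Real.log k / k := by positivity
  have p0 : ∀ i, 0 ≤ D i ^ 2 / 4 := fun i => by positivity
  have p1 : ∀ i, D i ^ 2 / 4 ≤ 1 := fun i => by linarith [h2 i]
  -- The threshold is `1 / √k`. Below it each entropy gains a factor `log k / 2` and Cauchy–Schwarz
  -- applies; a single term above it already costs more than order `log k / k`.
  by_cases hs : ∀ i ∈ Finset.Icc 1 k, D i ^ 2 / 4 ≤ Real.exp (-(Real.log k / 2))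
  · refine (mul_le_mul_of_nonneg_right (min_le_left _ _) hlk).trans ?_
    have cs := sq_sum_le_card_mul_sum_sq (s := Finset.Icc 1 k) (f := D)
    rw [Nat.card_Icc, Nat.add_sub_cancel] at cs
    have h3 : r ^ 2 / 4 / k ≤ ∑ i ∈ Finset.Icc 1 k, D i ^ 2 := by
      rw [div_le_iff₀ hk0]
      nlinarith
    calc r ^ 2 / 32 * (Real.log k / k) = (r ^ 2 / 4 / k) * (Real.log k / 8) := by ring
      _ ≤ (∑ i ∈ Finset.Icc 1 k, D i ^ 2) * (Real.log k / 8) := by gcongr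
      _ = ∑ i ∈ Finset.Icc 1 k, D i ^ 2 / 4 * (Real.log k / 2) := by
        rw [Finset.sum_mul]; exact Finset.sum_congr rfl fun i _ => by ring
      _ ≤ _ := Finset.sum_le_sum fun i hi => mul_le_binEntropy (p0 i) (p1 i) (hs i hi)
  · push Not at hs
    obtain ⟨i, hi, hs⟩ := hs
    refine (mul_le_mul_of_nonneg_right (min_le_right _ _) hlk).trans ?_
    refine le_trans ?_ (Finset.single_le_sum
      (f := fun i => Real.binEntropy (D i ^ 2 / 4))
      (fun j _ => Real.binEntropy_nonneg (p0 j) (p1 j)) hi)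
    have hb : D i ^ 2 / 4 * Real.log 2 ≤ Real.binEntropy (D i ^ 2 / 4) :=
      mul_le_binEntropy (p0 i) (p1 i) (by
        rw [Real.exp_neg, Real.exp_log two_pos]; linarith [h2 i])
    have hl2 := Real.log_pos one_lt_two
    -- This is `log k ≤ 2√k`, from `x + 1 ≤ exp x` at `x = log k / 2`.
    have he : Real.log k / k ≤ 2 * Real.exp (-(Real.log k / 2)) := by
      have e1 : (k : ℝ) = Real.exp (Real.log k / 2) * Real.exp (Real.log k / 2) := by
        rw [← Real.exp_add, add_halves, Real.exp_log hk0]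
      have e2 : Real.exp (-(Real.log k / 2)) * Real.exp (Real.log k / 2) = 1 := by
        rw [← Real.exp_add]; simp
      rw [div_le_iff₀ hk0]
      calc Real.log k ≤ 2 * Real.exp (Real.log k / 2) := by
            linarith [Real.add_one_le_exp (Real.log k / 2)]
        _ = 2 * (Real.exp (-(Real.log k / 2)) * Real.exp (Real.log k / 2)) *
              Real.exp (Real.log k / 2) := by rw [e2, mul_one]
        _ = 2 * Real.exp (-(Real.log k / 2)) *
              (Real.exp (Real.log k / 2) * Real.exp (Real.log k / 2)) := by ring
        _ = _ := by rw [← e1]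
    nlinarith

theorem le_CIC {k : ℕ} (hk : 1 ≤ k) (P : Protocol Bool Bool Bool k) {ε : ℝ} (hε : ε < 1 / 2)
    (h : P.Computes and ε) :
    2 / 3 * min ((√(1 - ε) - √ε) ^ 2 / 32) (Real.log 2 / 2) * (Real.logb 2 k / k) ≤ P.CIC U0 := by
  have hl2 := Real.log_pos one_lt_two
  have := sum_binEntropy_ge hk P.stepDist_sq_le
    (sub_nonneg.mpr (Real.sqrt_le_sqrt (by linarith : ε ≤ 1 - ε))) (P.le_sum_stepDist h)
  rw [P.CIC_eq]
  refine le_trans (le_of_eq ?_) (mul_le_mul_of_nonneg_left this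
    (by positivity : 0 ≤ 2 / 3 / Real.log 2))
  rw [Real.logb]
  ring

/-! ### The protocol of alternating reflections -/

/-- The real qubit state at angle `a`. -/
noncomputable def ket (a : ℝ) : Register 2 := !₂[(Real.cos a : ℂ), (Real.sin a : ℂ)]

theorem inner_ket (a b : ℝ) : inner ℂ (ket a) (ket b) = (Real.cos (b - a) : ℂ) := by
  rw [inner_register, Fin.sum_univ_two, Real.cos_sub]
  simp only [ket, PiLp.toLp_apply, Matrix.cons_val_zero, Matrix.cons_val_one, Complex.star_def,
    Complex.conj_ofReal]
  push_cast
  ring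

theorem norm_ket (a : ℝ) : ‖ket a‖ = 1 := by
  have h : ‖ket a‖ ^ 2 = 1 := by
    rw [EuclideanSpace.norm_sq_eq, Fin.sum_univ_two]
    simp [ket, -Complex.ofReal_cos, -Complex.ofReal_sin]
  exact (pow_eq_one_iff_of_nonneg (norm_nonneg _) two_ne_zero).mp h

/-- The reflection of the qubit plane exchanging the angles `a` and `t - a`. -/
noncomputable def reflection (t : ℝ) : Register 2 →ₗᵢ[ℂ] Register 2 where
  toLinearMap := Matrix.toEuclideanLin
    !![(Real.cos t : ℂ), (Real.sin t : ℂ); (Real.sin t : ℂ), -(Real.cos t : ℂ)]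
  norm_map' v := by
    rw [← sq_eq_sq₀ (norm_nonneg _) (norm_nonneg _), EuclideanSpace.norm_sq_eq,
      EuclideanSpace.norm_sq_eq, Fin.sum_univ_two, Fin.sum_univ_two]
    simp only [← Complex.normSq_eq_norm_sq, Complex.normSq_apply, Matrix.toLpLin_apply,
      PiLp.toLp_apply, Matrix.mulVec, dotProduct, Fin.sum_univ_two, Matrix.of_apply,
      Matrix.cons_val_zero, Matrix.cons_val_one, Matrix.cons_val', Matrix.cons_val_fin_one,
      Complex.add_re, Complex.add_im, Complex.neg_re, Complex.neg_im, Complex.mul_re,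
      Complex.mul_im, Complex.ofReal_re, Complex.ofReal_im]
    linear_combination ((v 0).re ^ 2 + (v 0).im ^ 2 + (v 1).re ^ 2 + (v 1).im ^ 2) *
      Real.sin_sq_add_cos_sq t

theorem reflection_ket (t a : ℝ) : reflection t (ket a) = ket (t - a) := by
  ext i
  fin_cases i <;>
    simp [reflection, ket, Matrix.toLpLin_apply, Complex.cos_sub, Complex.sin_sub] <;>
    ring

theorem pureState_posSemidef {d : ℕ} (u : Register d) : (pureState u).PosSemidef := by
  have e : pureState u = Matrix.vecMulVec u.ofLp (star u.ofLp) := by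
    ext i j; simp [pureState, Matrix.vecMulVec_apply]
  rw [e]
  exact Matrix.posSemidef_vecMulVec_self_star _

theorem pureState_ket_add (a : ℝ) : pureState (ket (a + Real.pi / 2)) + pureState (ket a) = 1 := by
  have h : (Real.sin a : ℂ) ^ 2 + (Real.cos a : ℂ) ^ 2 = 1 := by
    exact_mod_cast Real.sin_sq_add_cos_sq a
  ext i j
  fin_cases i <;> fin_cases j <;>
    simp only [pureState, ket, Real.cos_add_pi_div_two, Real.sin_add_pi_div_two, Matrix.add_apply,
      Matrix.of_apply, PiLp.toLp_apply, Complex.star_def, Complex.conj_ofReal, Complex.ofReal_neg,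
      Fin.zero_eta, Fin.mk_one, Matrix.cons_val_zero, Matrix.cons_val_one, Matrix.one_apply_eq,
      map_neg, ne_eq, zero_ne_one, one_ne_zero, not_false_eq_true, Matrix.one_apply_ne] <;>
    first
    | linear_combination h
    | ring

theorem trace_pureState_ket_mul (a b : ℝ) :
    (pureState (ket a) * pureState (ket b)).trace.re = Real.cos (b - a) ^ 2 := by
  rw [Real.cos_sub]
  simp only [Matrix.trace, Matrix.diag_apply, Matrix.mul_apply, Fin.sum_univ_two, pureState, ket,
    Matrix.of_apply, PiLp.toLp_apply, Complex.star_def, Complex.conj_ofReal, Matrix.cons_val_zero,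
    Matrix.cons_val_one, ← Complex.ofReal_mul, ← Complex.ofReal_add, Complex.ofReal_re]
  ring

/-- The measurement of the qubit in the basis of the angles `a` and `a + π / 2`. -/
noncomputable def ketPovm (a : ℝ) (z : Bool) : Matrix (Fin 2) (Fin 2) ℂ :=
  if z then pureState (ket (a + Real.pi / 2)) else pureState (ket a)

/-- Alternating reflections: on input `1` Alice reflects about angle `0`, Bob about angle `θ`. -/
noncomputable def reflectionProtocol (k : ℕ) (θ a : ℝ) : Protocol Bool Bool Bool k where
  dim _ := 2
  init := ket 0
  norm_init := norm_ket 0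
  alice _ x := if x then reflection 0 else LinearIsometry.id
  bob _ y := if y then reflection (2 * θ) else LinearIsometry.id
  -- On `y = 0` the conjunction is known to be false, so Bob answers without looking at the
  -- register.
  povm y z := if y then ketPovm a z else if z then 0 else 1
  povm_posSemidef y z := by
    cases y <;> cases z <;>
      simp [ketPovm, pureState_posSemidef, Matrix.PosSemidef.zero, Matrix.PosSemidef.one]
  povm_sum y := by
    cases y <;> simp [ketPovm, pureState_ket_add]

section ReflectionProtocol

variable (k : ℕ) (θ a : ℝ)

theorem reflectionProtocol_state_false (x : Bool) (i : ℕ) :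
    (reflectionProtocol k θ a).state x false i = ket 0 := by
  induction i with
  | zero => rfl
  | succ i ih =>
    rw [Protocol.state, ih]
    split_ifs
    · cases x
      · rfl
      · exact (reflection_ket _ _).trans (by rw [sub_zero])
    · rfl

theorem reflectionProtocol_state_false_true (i : ℕ) :
    (reflectionProtocol k θ a).state false true i = ket (θ * (1 - (-1) ^ (i / 2))) := by
  induction i with
  | zero => simp [Protocol.state, reflectionProtocol]
  | succ i ih =>
    rw [Protocol.state, ih]
    split_ifs with h
    · obtain ⟨j, rfl⟩ := h
      have e : (j + j + 1) / 2 = (j + j) / 2 := by omega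
      rw [e]; rfl
    · obtain ⟨j, rfl⟩ := Nat.not_even_iff_odd.mp h
      have e : (2 * j + 1 + 1) / 2 = (2 * j + 1) / 2 + 1 := by omega
      rw [e]
      refine (reflection_ket _ _).trans (congrArg ket ?_)
      ring

theorem reflectionProtocol_state_true_true (i : ℕ) :
    (reflectionProtocol k θ a).state true true i =
      ket (if Even i then i * θ else -((i - 1) * θ)) := by
  induction i with
  | zero => simp [Protocol.state, reflectionProtocol]
  | succ i ih =>
    rw [Protocol.state, ih]
    by_cases h : Even i
    · have h' : ¬ Even (i + 1) := by rw [Nat.even_add_one]; exact not_not_intro h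
      rw [if_pos h, if_pos h, if_neg h']
      refine (reflection_ket _ _).trans (congrArg ket ?_)
      push_cast; ring
    · have h' : Even (i + 1) := by rw [Nat.even_add_one]; exact h
      rw [if_neg h, if_neg h, if_pos h']
      refine (reflection_ket _ _).trans (congrArg ket ?_)
      push_cast; ring

variable {k θ}

/-- After the last round the state on `(0,1)` is at angle `0` or `2θ`, according to the parity of
`m`, and the state on `(1,1)` is at angle `-2mθ`. The condition on `θ` makes the two orthogonal, and
Bob measures in their basis, so no error occurs. -/
theorem reflectionProtocol_computes {m : ℕ} (hk : k = 2 * m + 1)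
    (hθ : θ * (2 * m + 1 - (-1) ^ m) = Real.pi / 2) {ε : ℝ} (hε : 0 ≤ ε) :
    (reflectionProtocol k θ (θ * (1 - (-1) ^ m))).Computes and ε := by
  have hm : k / 2 = m := by omega
  have ho : ¬ Even k := by rw [Nat.not_even_iff_odd]; exact ⟨m, hk⟩
  refine fun x y => (sub_le_self 1 hε).trans (le_of_eq ?_)
  rw [Protocol.outputProb]
  cases y
  · rw [reflectionProtocol_state_false, Bool.and_false]
    refine Eq.symm ((congrArg (fun M => (Matrix.trace M).re) (mul_one (pureState (ket 0)))).trans ?_)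
    rw [trace_pureState, norm_ket, one_pow]
  · cases x
    · rw [reflectionProtocol_state_false_true, hm]
      refine Eq.symm ((trace_pureState_ket_mul _ _).trans ?_)
      simp
    · rw [reflectionProtocol_state_true_true, if_neg ho]
      refine Eq.symm ((trace_pureState_ket_mul _ _).trans ?_)
      have : θ * (1 - (-1) ^ m) + Real.pi / 2 - -(((k : ℝ) - 1) * θ) = Real.pi := by
        rw [hk]; push_cast; linarith
      rw [this]; simp

/-- Alice's reflection fixes the initial state, so odd rounds cost nothing. In even rounds the angle
is `0` or `2θ`, and `(1 - |cos 2θ|) / 2 ≤ sin² θ`. -/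
theorem reflectionProtocol_stepDist_le (i : ℕ) :
    (reflectionProtocol k θ a).stepDist i ^ 2 / 4 ≤ Real.sin θ ^ 2 := by
  unfold Protocol.stepDist
  split_ifs
  · rw [reflectionProtocol_state_false, reflectionProtocol_state_false]
    have e : phaseDist (ket 0) (ket 0) ^ 2 / 4 ≤ Real.sin θ ^ 2 := by
      rw [phaseDist_self (norm_ket 0)]
      simpa using sq_nonneg (Real.sin θ)
    exact e
  · rw [reflectionProtocol_state_false, reflectionProtocol_state_false_true]
    have e : phaseDist (ket 0) (ket (θ * (1 - (-1) ^ (i / 2)))) ^ 2 / 4 ≤ Real.sin θ ^ 2 := by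
      rw [phaseDist, inner_ket, sub_zero, Real.sq_sqrt, Complex.norm_real, Real.norm_eq_abs]
      · rcases neg_one_pow_eq_or ℝ (i / 2) with h | h
        · rw [h]; simpa using sq_nonneg (Real.sin θ)
        · have : θ * (1 - -1) = 2 * θ := by ring
          rw [h, this, Real.cos_two_mul]
          have := le_abs_self (2 * Real.cos θ ^ 2 - 1)
          nlinarith [Real.sin_sq_add_cos_sq θ]
      · rw [Complex.norm_real, Real.norm_eq_abs]
        linarith [Real.abs_cos_le_one (θ * (1 - (-1) ^ (i / 2)))]
    exact e

end ReflectionProtocol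

/-! ### Cost of the reflection protocol and conclusion -/

theorem binEntropy_le_negMulLog_add {p : ℝ} (hp : p < 1) :
    Real.binEntropy p ≤ Real.negMulLog p + p := by
  rw [Real.binEntropy_eq_negMulLog_add_negMulLog_one_sub]
  have h : 0 < 1 - p := by linarith
  have := Real.one_sub_inv_le_log_of_pos h
  have := mul_le_mul_of_nonneg_left this h.le
  rw [mul_sub, mul_inv_cancel₀ h.ne'] at this
  simp only [Real.negMulLog]
  linarith

theorem exists_protocol_CIC_le {k : ℕ} (hk : Odd k) (hk3 : 3 ≤ k) {ε : ℝ} (hε : 0 ≤ ε) :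
    ∃ P : Protocol Bool Bool Bool k, P.Computes and ε ∧ P.CIC U0 ≤ 30 * (Real.logb 2 k / k) := by
  obtain ⟨m, hm⟩ := hk
  have hK : (3 : ℝ) ≤ k := by exact_mod_cast hk3
  have hK2 : (k : ℝ) = 2 * m + 1 := by rw [hm]; push_cast; ring
  -- The final angle between the states on `(0,1)` and `(1,1)` is `S * θ`. Here `S` is `k - 1` or `k
  -- + 1`, and `k ≥ 3` keeps it away from zero.
  obtain ⟨S, hS⟩ : ∃ S : ℝ, S = 2 * m + 1 - (-1) ^ m := ⟨_, rfl⟩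
  have hS1 : (k : ℝ) - 1 ≤ S ∧ S ≤ k + 1 := by
    rcases neg_one_pow_eq_or ℝ m with h | h <;> rw [h] at hS <;> constructor <;> linarith
  have hS2 : 2 ≤ S := by linarith
  have hpi := Real.pi_pos
  have hpi4 := Real.pi_le_four
  obtain ⟨θ, hθ⟩ : ∃ θ : ℝ, θ = Real.pi / 2 / S := ⟨_, rfl⟩
  have hθS : θ * S = Real.pi / 2 := by rw [hθ]; field_simp
  have hθ0 : 0 < θ := by rw [hθ]; positivity
  have hθ4 : θ ≤ Real.pi / 4 := by nlinarith
  have hl2 := Real.log_pos one_lt_two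
  have hs0 : 0 < Real.sin θ := Real.sin_pos_of_pos_of_lt_pi hθ0 (by linarith)
  have hsk : 1 ≤ (k + 1) * Real.sin θ := by
    have h1 := Real.mul_le_sin hθ0.le (by linarith)
    have h2 : 2 / Real.pi * θ = 1 / S := by rw [hθ]; field_simp
    rw [h2, div_le_iff₀ (by linarith)] at h1
    nlinarith
  have hsk' : Real.sin θ * k ≤ 3 := by
    have h1 := Real.sin_le hθ0.le
    have h2 : θ * k ≤ 3 := by nlinarith
    nlinarith
  have hsq : Real.sin θ ^ 2 ≤ 1 / 2 := by
    have h : Real.sin θ ≤ Real.sin (Real.pi / 4) :=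
      Real.sin_le_sin_of_le_of_le_pi_div_two (by linarith) (by linarith) hθ4
    rw [Real.sin_pi_div_four] at h
    have := pow_le_pow_left₀ hs0.le h 2
    rw [div_pow, Real.sq_sqrt two_pos.le] at this
    linarith
  have hlk : 1 ≤ Real.log k := by
    rw [Real.le_log_iff_exp_le (by linarith)]
    linarith [Real.exp_one_lt_d9]
  have hlog : -Real.log (Real.sin θ ^ 2) ≤ 4 * Real.log k := by
    have h1 : 0 ≤ Real.log ((k + 1) * Real.sin θ) := Real.log_nonneg hsk
    rw [Real.log_mul (by positivity) hs0.ne'] at h1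
    have h2 : Real.log (k + 1) ≤ Real.log ((k : ℝ) ^ 2) :=
      Real.log_le_log (by positivity) (by nlinarith)
    rw [Real.log_pow] at h2 ⊢
    push_cast at h2 ⊢
    linarith
  -- `45 = 9 * 5`: the `9` is from `sin θ ≤ 3 / k`, and the `5` from `-log (sin² θ) ≤ 4 log k`
  -- together with `1 ≤ log k`. The factor `2/3` in the cost then gives `30`.
  have hb : Real.binEntropy (Real.sin θ ^ 2) ≤ 45 * (Real.log k / k ^ 2) := by
    refine (binEntropy_le_negMulLog_add (by linarith)).trans ?_
    have h1 : Real.sin θ ^ 2 ≤ 9 / k ^ 2 := by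
      rw [le_div_iff₀ (by positivity), ← mul_pow]
      have := pow_le_pow_left₀ (by positivity) hsk' 2
      linarith
    calc Real.negMulLog (Real.sin θ ^ 2) + Real.sin θ ^ 2
        = Real.sin θ ^ 2 * (-Real.log (Real.sin θ ^ 2) + 1) := by rw [Real.negMulLog]; ring
      _ ≤ Real.sin θ ^ 2 * (5 * Real.log k) := by gcongr; linarith
      _ ≤ 9 / k ^ 2 * (5 * Real.log k) := by gcongr
      _ = _ := by ring
  refine ⟨reflectionProtocol k θ (θ * (1 - (-1) ^ m)),
    reflectionProtocol_computes hm (hS ▸ hθS) hε, ?_⟩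
  rw [Protocol.CIC_eq]
  have hsum : ∑ i ∈ Finset.Icc 1 k, Real.binEntropy
      ((reflectionProtocol k θ (θ * (1 - (-1) ^ m))).stepDist i ^ 2 / 4) ≤
      k * (45 * (Real.log k / k ^ 2)) := by
    refine (Finset.sum_le_card_nsmul _ _ (45 * (Real.log k / k ^ 2)) fun i _ => ?_).trans
      (by simp)
    have hi := reflectionProtocol_stepDist_le (k := k) (θ := θ) (θ * (1 - (-1) ^ m)) i
    -- Binary entropy increases only up to `1/2`, which is why `sin² θ ≤ 1/2` is needed.
    refine (Real.binEntropy_strictMonoOn.monotoneOn ⟨by positivity, ?_⟩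
      ⟨by positivity, ?_⟩ hi).trans hb <;> linarith
  refine (mul_le_mul_of_nonneg_left hsum (by positivity)).trans (le_of_eq ?_)
  rw [Real.logb]
  field_simp
  norm_num

end MemorylessQuantum

theorem theorem1 (ε : ℝ) (hε0 : 0 < ε) (hε : ε < 1 / 2) :
    ∃ c C : ℝ, 0 < c ∧ 0 < C ∧ ∀ k : ℕ, Odd k → 3 ≤ k →
      IsGLB (MemorylessQuantum.cicValues MemorylessQuantum.U0 ε k and)
        (MemorylessQuantum.cicML MemorylessQuantum.U0 ε k and) ∧
      c * (Real.logb 2 k / k) ≤ MemorylessQuantum.cicML MemorylessQuantum.U0 ε k and ∧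
      MemorylessQuantum.cicML MemorylessQuantum.U0 ε k and ≤ C * (Real.logb 2 k / k) := by
  have hr : 0 < √(1 - ε) - √ε := sub_pos.mpr (Real.sqrt_lt_sqrt hε0.le (by linarith))
  have hl2 := Real.log_pos one_lt_two
  refine ⟨2 / 3 * min ((√(1 - ε) - √ε) ^ 2 / 32) (Real.log 2 / 2), 30, by positivity,
    by norm_num, fun k hk hk3 => ?_⟩
  obtain ⟨P, hP, hC⟩ := MemorylessQuantum.exists_protocol_CIC_le hk hk3 hε0.le
  have hne : (MemorylessQuantum.cicValues MemorylessQuantum.U0 ε k and).Nonempty := ⟨_, P, hP, rfl⟩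
  have hbdd : BddBelow (MemorylessQuantum.cicValues MemorylessQuantum.U0 ε k and) :=
    ⟨0, by rintro _ ⟨Q, -, rfl⟩; exact Q.CIC_nonneg⟩
  refine ⟨isGLB_csInf hne hbdd, le_csInf hne ?_, (csInf_le hbdd ⟨P, hP, rfl⟩).trans hC⟩
  rintro _ ⟨Q, hQ, rfl⟩
  exact MemorylessQuantum.le_CIC (by omega) Q hε hQ
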